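/- Let $(\Omega,\mathcal A,\nu)$ be a probability space and let $H=L_2(\Omega,\mathcal A,\nu)$ be the complex Hilbert space with inner product $\langle g,h\rangle=\int\bar g\,h\,d\nu$. Let $\rho$ be a density operator on $H$, that is, a positive trace-class operator with $\mathrm{tr}(\rho)=1$. For $A\in\mathcal A$ put $\mu(A)=|\chi_A\rangle\langle\chi_A|$, i.e. $\mu(A)g=\langle\chi_A,g\rangle\chi_A$, and $\mu_\rho(A)=\mathrm{tr}(\rho\,\mu(A))$. Let $f\colon\Omega\to\mathbb R$ be a measurable function with $\int f^2\,d\nu<\infty$ and $f\ge 0$ $\nu$-almost everywhere, and let $\widehat f$ be the bounded operator on $H$ given by $$(\widehat f g)(y)=\int\min[f(x),f(y)]\,g(x)\,d\nu(x).$$ **Theorem 3.4 (tail-sum formula).** For every $A\in\mathcal A$ the operator $\rho\,\mu(A)$ is trace class and $\mu_\rho(A)=\langle\rho\chi_A,\chi_A\rangle$. The operator $\rho\widehat f$ is trace class, the function $\lambda\mapsto\mu_\rho\{x: f(x)>\lambda\}$ is Lebesgue integrable on $(0,\infty)$, and the quantum integral $\int f\,d\mu_\rho=\mathrm{tr}(\rho\widehat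 f)$ satisfies $$\int f\,d\mu_\rho=\mathrm{tr}(\rho\widehat f)=\int_0^\infty\mu_\rho\{x: f(x)>\lambda\}\,d\lambda .$$ -/

import Mathlib

open MeasureTheory InnerProductSpace

noncomputable section

namespace QuantumIntegral

/-! ### Trace-class operators, trace and density operators on a complex Hilbert space -/

section Trace

variable {E : Type*} [NormedAddCommGroup E] [InnerProductSpace ℂ E] [CompleteSpace E]

/-- The index set of a chosen orthonormal basis of `E`. -/
def basisIndex (E : Type*) [NormedAddCommGroup E] [InnerProductSpace ℂ E] [CompleteSpace E] :
    Set E :=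
  (exists_hilbertBasis ℂ E).choose

/-- A chosen orthonormal basis of `E` (neither trace-class membership nor the trace of a
trace-class operator depends on the choice). -/
def basis (E : Type*) [NormedAddCommGroup E] [InnerProductSpace ℂ E] [CompleteSpace E] :
    HilbertBasis (basisIndex E) ℂ E :=
  (exists_hilbertBasis ℂ E).choose_spec.choose

/-- `T` is trace class: `∑ ⟪eᵢ, |T| eᵢ⟫ < ∞`, where `|T| = (T† T)^(1/2)`. -/
def IsTraceClass (T : E →L[ℂ] E) : Prop :=
  Summable fun i => inner ℂ (basis E i) (CFC.abs T (basis E i))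

/-- The trace `∑ ⟪eᵢ, T eᵢ⟫` (meaningful for trace-class `T`). -/
def trace (T : E →L[ℂ] E) : ℂ :=
  ∑' i, inner ℂ (basis E i) (T (basis E i))

/-- A density operator (state): a positive trace-class operator of trace one. -/
structure IsDensityOperator (ρ : E →L[ℂ] E) : Prop where
  isPositive : ρ.IsPositive
  isTraceClass : IsTraceClass ρ
  trace_eq_one : trace ρ = 1

end Trace

variable {Ω : Type*} [MeasurableSpace Ω] {ν : Measure Ω} [IsProbabilityMeasure ν]

/-! ### The q-measure of a state -/

/-- The characteristic function of an event, as an element of `L₂(Ω, ν)`. -/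
def chi (ν : Measure Ω) [IsProbabilityMeasure ν] (A : Set Ω) (hA : MeasurableSet A) :
    Lp ℂ 2 ν :=
  indicatorConstLp 2 hA (measure_ne_top ν A) 1

/-- The q-measure operator `μ(A) = |χ_A⟩⟨χ_A|`. -/
def qMeasureOp (ν : Measure Ω) [IsProbabilityMeasure ν] (A : Set Ω) (hA : MeasurableSet A) :
    Lp ℂ 2 ν →L[ℂ] Lp ℂ 2 ν :=
  rankOne ℂ (chi ν A hA) (chi ν A hA)

/-- The q-measure `μ_ρ(A) = tr(ρ μ(A))`. -/
def qMeasure (ρ : Lp ℂ 2 ν →L[ℂ] Lp ℂ 2 ν) (A : Set Ω) (hA : MeasurableSet A) : ℂ :=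
  trace (ρ ∘L qMeasureOp ν A hA)

/-! ### The quantization of a nonnegative random variable -/

/-- `y ↦ ∫ min(f(x), f(y)) g(x) dν(x)`. -/
def minIntegral (ν : Measure Ω) (f : Ω → ℝ) (g : Ω → ℂ) (y : Ω) : ℂ :=
  ∫ x, ((min (f x) (f y) : ℝ) : ℂ) * g x ∂ν

lemma integrable_mul_norm {f : Ω → ℝ} (hf2 : MemLp f 2 ν) (g : Lp ℂ 2 ν) :
    Integrable (fun x => f x * ‖g x‖) ν :=
  hf2.integrable_mul (Lp.memLp g).norm

lemma norm_min_mul_le {f : Ω → ℝ} (hf0 : 0 ≤ᵐ[ν] f) (g : Ω → ℂ) {y : Ω} (hy : 0 ≤ f y) :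
    ∀ᵐ x ∂ν, ‖((min (f x) (f y) : ℝ) : ℂ) * g x‖ ≤ f x * ‖g x‖ := by
  filter_upwards [hf0] with x hx
  rw [norm_mul, Complex.norm_real, Real.norm_eq_abs, abs_of_nonneg (le_min hx hy)]
  exact mul_le_mul_of_nonneg_right (min_le_left _ _) (norm_nonneg _)

lemma integrable_min_mul {f : Ω → ℝ} (hf : Measurable f) (hf2 : MemLp f 2 ν)
    (hf0 : 0 ≤ᵐ[ν] f) (g : Lp ℂ 2 ν) {y : Ω} (hy : 0 ≤ f y) :
    Integrable (fun x => ((min (f x) (f y) : ℝ) : ℂ) * g x) ν := by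
  refine (integrable_mul_norm hf2 g).mono' ?_ (norm_min_mul_le hf0 g hy)
  exact (Complex.measurable_ofReal.comp (hf.min measurable_const)).aestronglyMeasurable.mul
    (Lp.aestronglyMeasurable g)

lemma norm_minIntegral_le {f : Ω → ℝ} (hf2 : MemLp f 2 ν) (hf0 : 0 ≤ᵐ[ν] f) (g : Lp ℂ 2 ν) :
    ∀ᵐ y ∂ν, ‖minIntegral ν f g y‖ ≤ ‖hf2.toLp f‖ * ‖g‖ := by
  have hCS : ∫ x, f x * ‖g x‖ ∂ν ≤ ‖hf2.toLp f‖ * ‖g‖ := by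
    have hg := (Lp.memLp g).norm
    have h1 := real_inner_le_norm (hf2.toLp f) (hg.toLp _)
    have h2 : ‖hg.toLp _‖ = ‖g‖ := by
      rw [Lp.norm_toLp, eLpNorm_norm, Lp.norm_def]
    rw [h2, L2.inner_def] at h1
    refine le_trans (le_of_eq (integral_congr_ae ?_)) h1
    filter_upwards [hf2.coeFn_toLp, hg.coeFn_toLp] with x hx hx'
    rw [hx, hx']
    simp [mul_comm]
  filter_upwards [hf0] with y hy
  exact (norm_integral_le_of_norm_le (integrable_mul_norm hf2 g)
    (norm_min_mul_le hf0 g hy)).trans hCS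

lemma memLp_minIntegral {f : Ω → ℝ} (hf : Measurable f) (hf2 : MemLp f 2 ν) (hf0 : 0 ≤ᵐ[ν] f)
    (g : Lp ℂ 2 ν) : MemLp (minIntegral ν f g) 2 ν := by
  refine MemLp.of_bound (StronglyMeasurable.aestronglyMeasurable ?_) _
    (norm_minIntegral_le hf2 hf0 g)
  refine StronglyMeasurable.integral_prod_right
    (f := fun y x => ((min (f x) (f y) : ℝ) : ℂ) * g x) ?_
  exact (Complex.measurable_ofReal.comp
    ((hf.comp measurable_snd).min (hf.comp measurable_fst))).stronglyMeasurable.mul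
      ((Lp.stronglyMeasurable g).comp_measurable measurable_snd)

/-- The quantization `f̂` of a nonnegative random variable `f`: the bounded operator on
`L₂(Ω, ν)` given by `(f̂ g)(y) = ∫ min(f(x), f(y)) g(x) dν(x)`. -/
def quantization (f : Ω → ℝ) (hf : Measurable f) (hf2 : MemLp f 2 ν) (hf0 : 0 ≤ᵐ[ν] f) :
    Lp ℂ 2 ν →L[ℂ] Lp ℂ 2 ν :=
  LinearMap.mkContinuous
    { toFun := fun g => (memLp_minIntegral hf hf2 hf0 g).toLp (minIntegral ν f g)
      map_add' := fun g h => by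
        rw [← MemLp.toLp_add, MemLp.toLp_eq_toLp_iff]
        filter_upwards [hf0] with y hy
        simp only [minIntegral, Pi.add_apply]
        rw [← integral_add (integrable_min_mul hf hf2 hf0 g hy)
          (integrable_min_mul hf hf2 hf0 h hy)]
        refine integral_congr_ae ?_
        filter_upwards [Lp.coeFn_add g h] with x hx
        rw [hx, Pi.add_apply, mul_add]
      map_smul' := fun c g => by
        rw [RingHom.id_apply, ← MemLp.toLp_const_smul, MemLp.toLp_eq_toLp_iff]
        refine Filter.Eventually.of_forall fun y => ?_
        simp only [minIntegral, Pi.smul_apply, smul_eq_mul]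
        rw [← integral_const_mul]
        refine integral_congr_ae ?_
        filter_upwards [Lp.coeFn_smul c g] with x hx
        rw [hx, Pi.smul_apply, smul_eq_mul, mul_left_comm] }
    ‖hf2.toLp f‖
    (fun g => by
      have h := Lp.norm_le_of_ae_bound (f := (memLp_minIntegral hf hf2 hf0 g).toLp _)
        (C := ‖hf2.toLp f‖ * ‖g‖) (by positivity) (by
          filter_upwards [(memLp_minIntegral hf hf2 hf0 g).coeFn_toLp,
            norm_minIntegral_le hf2 hf0 g] with y hy hy'
          rw [hy]
          exact hy')
      simpa [measureUnivNNReal] using h)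

/-- The q-integral `∫ f dμ_ρ = tr(ρ f̂)` of a nonnegative random variable `f`. -/
def qIntegral (ρ : Lp ℂ 2 ν →L[ℂ] Lp ℂ 2 ν) (f : Ω → ℝ) (hf : Measurable f)
    (hf2 : MemLp f 2 ν) (hf0 : 0 ≤ᵐ[ν] f) : ℂ :=
  trace (ρ ∘L quantization f hf hf2 hf0)

end QuantumIntegral

end

/-! For `a, b ≥ 0`, `min a b` is the length of the set of `t > 0` with `t < a` and `t < b`. Hence
`f̂` is weakly the integral of `|χ_t⟩⟨χ_t|` over `t > 0`, where `χ_t` is the indicator of `{f > t}`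
(`inner_quantization`, by Fubini). The formula follows by pairing with `ρ`, once the trace sum and
the `t`-integral are exchanged. The absolute diagonal terms sum to at most `‖ρ χ_t‖² + ‖χ_t‖² ≤
(‖ρ‖² + 1) ν{f > t}`, which is integrable in `t` because `f` is in `L¹`. The space may be
nonseparable, but only countably many basis vectors survive `ρ`.

Trace-class membership of `ρ B` uses that `S = √ρ` is Hilbert–Schmidt: `|ρB|` is nearly `V†ρB` with
`‖V‖ ≤ 1`, whose diagonal entries are `⟪S V e, S B e⟫`. -/

namespace QuantumIntegral

/-! ### Hilbert–Schmidt sums -/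

section HilbertSchmidt

variable {ι E : Type*} [NormedAddCommGroup E] [InnerProductSpace ℂ E]

lemma hasSum_norm_inner_sq (b : HilbertBasis ι ℂ E) (x : E) :
    HasSum (fun i => ‖inner ℂ (b i) x‖ ^ 2) (‖x‖ ^ 2) := by
  have h := b.hasSum_inner_mul_inner x x
  rw [inner_self_eq_norm_sq_to_K] at h
  have h' := Complex.hasSum_re h
  convert h' using 1
  · ext i
    rw [← inner_conj_symm x (b i), mul_comm, Complex.mul_conj, Complex.normSq_eq_norm_sq]
    exact (Complex.ofReal_re _).symm.trans (by push_cast; rfl)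
  · norm_cast

lemma tsum_enorm_inner_sq (b : HilbertBasis ι ℂ E) (x : E) :
    ∑' i, ‖inner ℂ (b i) x‖ₑ ^ 2 = ‖x‖ₑ ^ 2 := by
  have h := hasSum_norm_inner_sq b x
  have := ENNReal.ofReal_tsum_of_nonneg (fun i => sq_nonneg ‖inner ℂ (b i) x‖) h.summable
  rw [h.tsum_eq] at this
  simpa only [ENNReal.ofReal_pow (norm_nonneg _), ofReal_norm] using this.symm

variable [CompleteSpace E]

/-- Both sides sum the squared moduli of the matrix entries of `A`; in `[0, ∞]` the order of
summation is free. -/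
lemma tsum_enorm_sq_adjoint (b : HilbertBasis ι ℂ E) (A : E →L[ℂ] E) :
    ∑' i, ‖ContinuousLinearMap.adjoint A (b i)‖ₑ ^ 2 = ∑' i, ‖A (b i)‖ₑ ^ 2 := by
  calc ∑' i, ‖ContinuousLinearMap.adjoint A (b i)‖ₑ ^ 2
      = ∑' i, ∑' j, ‖inner ℂ (b j) (ContinuousLinearMap.adjoint A (b i))‖ₑ ^ 2 := by
        simp_rw [tsum_enorm_inner_sq]
    _ = ∑' j, ∑' i, ‖inner ℂ (b j) (ContinuousLinearMap.adjoint A (b i))‖ₑ ^ 2 :=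
        ENNReal.tsum_comm
    _ = ∑' j, ∑' i, ‖inner ℂ (b i) (A (b j))‖ₑ ^ 2 := by
        refine tsum_congr fun j => tsum_congr fun i => ?_
        rw [ContinuousLinearMap.adjoint_inner_right, ← ofReal_norm, norm_inner_symm, ofReal_norm]
    _ = _ := by simp_rw [tsum_enorm_inner_sq]

/-- Composing a self-adjoint Hilbert–Schmidt operator with a bounded one on the right. -/
lemma summable_norm_sq_comp (b : HilbertBasis ι ℂ E) {S : E →L[ℂ] E} (hS : IsSelfAdjoint S)
    (h : Summable fun i => ‖S (b i)‖ ^ 2) (B : E →L[ℂ] E) :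
    Summable (fun i => ‖S (B (b i))‖ ^ 2) ∧
      ∑' i, ‖S (B (b i))‖ ^ 2 ≤ ‖B‖ ^ 2 * ∑' i, ‖S (b i)‖ ^ 2 := by
  have key : ∑' i, ENNReal.ofReal (‖S (B (b i))‖ ^ 2) ≤
      ENNReal.ofReal (‖B‖ ^ 2 * ∑' i, ‖S (b i)‖ ^ 2) := by
    -- Passing to `(S B)† = B† S` puts the bounded factor outermost, where it costs only `‖B‖`.
    have h1 := tsum_enorm_sq_adjoint b (S ∘L B)
    rw [ContinuousLinearMap.adjoint_comp, hS.adjoint_eq] at h1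
    rw [ENNReal.ofReal_mul (by positivity), ENNReal.ofReal_tsum_of_nonneg (fun i => by positivity) h,
      ← ENNReal.tsum_mul_left]
    simp only [ENNReal.ofReal_pow (norm_nonneg _), ofReal_norm]
    refine h1.symm.le.trans (ENNReal.tsum_le_tsum fun i => ?_)
    rw [← mul_pow]
    gcongr
    have := (ContinuousLinearMap.adjoint B).le_opENorm (S (b i))
    rw [← ofReal_norm (ContinuousLinearMap.adjoint B), LinearIsometryEquiv.norm_map, ofReal_norm]
      at this
    exact this
  have hs : Summable fun i => ‖S (B (b i))‖ ^ 2 := by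
    refine (ENNReal.summable_toReal (ne_top_of_le_ne_top ENNReal.ofReal_ne_top key)).congr
      fun i => ENNReal.toReal_ofReal (by positivity)
  refine ⟨hs, ?_⟩
  rw [← ENNReal.ofReal_tsum_of_nonneg (fun i => by positivity) hs] at key
  exact (ENNReal.ofReal_le_ofReal_iff (mul_nonneg (by positivity)
    (tsum_nonneg fun i => by positivity))).1 key

end HilbertSchmidt

/-! ### Trace-class operators and the square root of a state -/

section TraceClass

variable {E : Type*} [NormedAddCommGroup E] [InnerProductSpace ℂ E] [CompleteSpace E]

/-- An approximate polar decomposition: `V† T` approximates `|T|` with `V` a contraction. -/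
lemma exists_adjoint_comp_near_abs (T : E →L[ℂ] E) {ε : ℝ} (hε : 0 < ε) :
    ∃ V : E →L[ℂ] E, ‖V‖ ≤ 1 ∧ ‖CFC.abs T - ContinuousLinearMap.adjoint V ∘L T‖ ≤ ε := by
  set P := CFC.abs T with hP
  have hP0 : 0 ≤ P := CFC.abs_nonneg T
  have hPs : IsSelfAdjoint P := hP0.isSelfAdjoint
  have hPP : P * P = star T * T := CFC.abs_mul_abs T
  have hden : ∀ x : ℝ, |x| + ε ≠ 0 := fun x => by positivity
  have hr : Continuous fun x : ℝ => (|x| + ε)⁻¹ :=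
    (continuous_abs.add continuous_const).inv₀ hden
  -- `V = T (P + ε)⁻¹` regularises the polar part: `V†V = (P / (P + ε))² ≤ 1` and `P - V†T = ε P /
  -- (P + ε)`. The absolute value makes the function continuous on all of `ℝ`.
  set R := cfc (fun x : ℝ => (|x| + ε)⁻¹) P with hR
  have hRs : star R = R := (cfc_predicate (fun x : ℝ => (|x| + ε)⁻¹) P : IsSelfAdjoint R)
  have hid : cfc (fun x : ℝ => x) P = P := cfc_id' ℝ P
  have hRPP : R * (P * P) = cfc (fun x : ℝ => (|x| + ε)⁻¹ * (x * x)) P := by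
    rw [cfc_mul _ _ P hr.continuousOn (by fun_prop), cfc_mul _ _ P, hid]
  have hRPPR : R * (P * P) * R = cfc (fun x : ℝ => (|x| + ε)⁻¹ * (x * x) * (|x| + ε)⁻¹) P := by
    rw [cfc_mul _ _ P (by fun_prop) hr.continuousOn, hRPP]
  have hVV : star (T * R) * (T * R) = R * (P * P) * R := by
    rw [star_mul, hRs, hPP]; simp only [mul_assoc]
  refine ⟨T * R, ?_, ?_⟩
  · have h1 : ‖T * R‖ * ‖T * R‖ ≤ 1 := by
      rw [← CStarRing.norm_star_mul_self, hVV, hRPPR]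
      refine norm_cfc_le zero_le_one fun x _ => ?_
      have : (|x| + ε)⁻¹ * (x * x) * (|x| + ε)⁻¹ = (|x| / (|x| + ε)) ^ 2 := by
        rw [← abs_mul_abs_self x]; field_simp
      rw [this, Real.norm_of_nonneg (by positivity)]
      refine pow_le_one₀ (by positivity) ((div_le_one (by positivity)).2 (by linarith))
    nlinarith [norm_nonneg (T * R)]
  · have h2 : ContinuousLinearMap.adjoint (T * R) ∘L T = R * (P * P) := by
      rw [← ContinuousLinearMap.star_eq_adjoint, ← ContinuousLinearMap.mul_def, star_mul, hRs, hPP,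
        mul_assoc]
    rw [h2, hRPP]
    nth_rewrite 1 [← hid]
    rw [← cfc_sub _ _ P (by fun_prop) (by fun_prop)]
    refine norm_cfc_le hε.le fun x hx => ?_
    have hx0 : 0 ≤ x := spectrum_nonneg_of_nonneg hP0 hx
    rw [abs_of_nonneg hx0]
    have : x - (x + ε)⁻¹ * (x * x) = ε * (x / (x + ε)) := by field_simp; ring
    rw [this, Real.norm_of_nonneg (by positivity)]
    exact mul_le_of_le_one_right hε.le ((div_le_one (by positivity)).2 (by linarith))

lemma norm_sqrt_apply_sq {ρ : E →L[ℂ] E} (hρ : ρ.IsPositive) (x : E) :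
    ((‖CFC.sqrt ρ x‖ ^ 2 : ℝ) : ℂ) = inner ℂ x (ρ x) := by
  have h0 : 0 ≤ ρ := (ContinuousLinearMap.nonneg_iff_isPositive ρ).2 hρ
  have hs : IsSelfAdjoint (CFC.sqrt ρ) := (CFC.sqrt_nonneg ρ).isSelfAdjoint
  conv_rhs => rw [← CFC.sqrt_mul_sqrt_self ρ h0, mul_apply_eq_comp,
    ← ContinuousLinearMap.adjoint_inner_left, hs.adjoint_eq, inner_self_eq_norm_sq_to_K]
  norm_cast

lemma summable_norm_sqrt_sq {ρ : E →L[ℂ] E} (hρ : ρ.IsPositive) (ht : IsTraceClass ρ) :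
    Summable fun i => ‖CFC.sqrt ρ (basis E i)‖ ^ 2 := by
  have h0 : 0 ≤ ρ := (ContinuousLinearMap.nonneg_iff_isPositive ρ).2 hρ
  rw [IsTraceClass, CFC.abs_of_nonneg ρ h0] at ht
  simp_rw [← norm_sqrt_apply_sq hρ] at ht
  exact Complex.summable_ofReal.1 ht

/-- Stands in for separability when the trace is exchanged with the integral. -/
lemma countable_support_apply_basis {ρ : E →L[ℂ] E} (hρ : ρ.IsPositive) (ht : IsTraceClass ρ) :
    {i | ρ (basis E i) ≠ 0}.Countable := by
  refine (summable_norm_sqrt_sq hρ ht).countable_support.mono fun i hi => mt (fun h => ?_) hi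
  have h0 : 0 ≤ ρ := (ContinuousLinearMap.nonneg_iff_isPositive ρ).2 hρ
  rw [← CFC.sqrt_mul_sqrt_self ρ h0, mul_apply_eq_comp,
    norm_eq_zero.1 (pow_eq_zero_iff two_ne_zero |>.1 h), map_zero]

/-- Trace-class operators absorb bounded operators on the right. -/
lemma IsTraceClass.comp_of_isPositive {ρ : E →L[ℂ] E} (hρ : ρ.IsPositive) (ht : IsTraceClass ρ)
    (B : E →L[ℂ] E) : IsTraceClass (ρ ∘L B) := by
  have h0 : 0 ≤ ρ := (ContinuousLinearMap.nonneg_iff_isPositive ρ).2 hρ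
  set S := CFC.sqrt ρ
  have hS : IsSelfAdjoint S := (CFC.sqrt_nonneg ρ).isSelfAdjoint
  have hsum := summable_norm_sqrt_sq hρ ht
  set C := ∑' i, ‖S (basis E i)‖ ^ 2
  have hC : 0 ≤ C := tsum_nonneg fun i => by positivity
  have habs : (CFC.abs (ρ ∘L B)).IsPositive :=
    (ContinuousLinearMap.nonneg_iff_isPositive _).1 (CFC.abs_nonneg _)
  -- Diagonal entries of `|ρB|` equal their own norms, so bounding finite partial sums suffices.
  have hreal : ∀ i, ((‖inner ℂ (basis E i) (CFC.abs (ρ ∘L B) (basis E i))‖ : ℝ) : ℂ) =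
      inner ℂ (basis E i) (CFC.abs (ρ ∘L B) (basis E i)) := fun i => by
    rw [← norm_sqrt_apply_sq habs, Complex.norm_real, Real.norm_of_nonneg (by positivity)]
  rw [IsTraceClass, ← funext hreal]
  refine Complex.summable_ofReal.2 (summable_of_sum_le (c := C + ‖B‖ ^ 2 * C)
    (fun i => norm_nonneg _) fun s => ?_)
  refine le_of_forall_pos_le_add fun δ hδ => ?_
  -- `V` may depend on the finite set `s`: the error per term is chosen to total at most `δ`, and
  -- the `+ 1` covers empty `s`.
  obtain ⟨V, hV, hVε⟩ := exists_adjoint_comp_near_abs (ρ ∘L B) (ε := δ / (s.card + 1))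
    (by positivity)
  have hterm : ∀ i ∈ s, ‖inner ℂ (basis E i) (CFC.abs (ρ ∘L B) (basis E i))‖ ≤
      (‖S (V (basis E i))‖ ^ 2 + ‖S (B (basis E i))‖ ^ 2) + δ / (s.card + 1) := fun i _ => by
    have hi : ‖basis E i‖ = 1 := (basis E).orthonormal.1 i
    have hsplit : inner ℂ (basis E i) (CFC.abs (ρ ∘L B) (basis E i)) =
        inner ℂ (S (V (basis E i))) (S (B (basis E i))) +
        inner ℂ (basis E i) ((CFC.abs (ρ ∘L B) - ContinuousLinearMap.adjoint V ∘L (ρ ∘L B))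
          (basis E i)) := by
      rw [sub_apply, inner_sub_right, ContinuousLinearMap.comp_apply,
        ContinuousLinearMap.adjoint_inner_right, ← ContinuousLinearMap.adjoint_inner_right,
        hS.adjoint_eq, ← mul_apply_eq_comp S S, CFC.sqrt_mul_sqrt_self ρ h0]
      simp
    rw [hsplit]
    refine (norm_add_le _ _).trans (add_le_add ?_ ?_)
    · refine (norm_inner_le_norm _ _).trans ?_
      nlinarith [sq_nonneg (‖S (V (basis E i))‖ - ‖S (B (basis E i))‖),
        sq_nonneg ‖S (V (basis E i))‖, sq_nonneg ‖S (B (basis E i))‖]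
    · refine (norm_inner_le_norm _ _).trans ?_
      rw [hi, one_mul]
      refine (ContinuousLinearMap.le_opNorm _ _).trans ?_
      rw [hi, mul_one]
      exact hVε
  refine (Finset.sum_le_sum hterm).trans ?_
  rw [Finset.sum_add_distrib, Finset.sum_add_distrib, Finset.sum_const, nsmul_eq_mul]
  obtain ⟨hVs, hVC⟩ := summable_norm_sq_comp (basis E) hS hsum V
  obtain ⟨hBs, hBC⟩ := summable_norm_sq_comp (basis E) hS hsum B
  have h1 := (hVs.sum_le_tsum s fun i _ => by positivity).trans hVC
  have h2 := (hBs.sum_le_tsum s fun i _ => by positivity).trans hBC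
  have h3 : ‖V‖ ^ 2 * C ≤ C :=
    mul_le_of_le_one_left hC (pow_le_one₀ (norm_nonneg _) hV)
  have h4 : (s.card : ℝ) * (δ / (s.card + 1)) ≤ δ := by
    rw [mul_div_left_comm]
    exact mul_le_of_le_one_right hδ.le ((div_le_one (by positivity)).2 (by linarith))
  exact add_le_add (add_le_add (h1.trans h3) h2) h4

end TraceClass

variable {Ω : Type*} [MeasurableSpace Ω] {ν : Measure Ω} [IsProbabilityMeasure ν]

/-! ### Layer-cake representation of the kernel -/

section SuperlevelKernel

/-- The indicator of `t < f x`. -/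
noncomputable def levelInd {Ω : Type*} (f : Ω → ℝ) (t : ℝ) (x : Ω) : ℂ := (Set.Iio (f x)).indicator 1 t

lemma measurable_levelInd {f : Ω → ℝ} (hf : Measurable f) :
    Measurable fun p : ℝ × Ω => levelInd f p.1 p.2 := by
  have : (fun p : ℝ × Ω => levelInd f p.1 p.2) =
      {p : ℝ × Ω | p.1 < f p.2}.indicator 1 := by
    ext p; simp [levelInd, Set.indicator_apply]
  rw [this]
  exact measurable_one.indicator (measurableSet_lt measurable_fst (hf.comp measurable_snd))

lemma levelInd_mul_levelInd {Ω : Type*} (f : Ω → ℝ) (t : ℝ) (x y : Ω) :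
    levelInd f t x * levelInd f t y = (Set.Iio (min (f x) (f y))).indicator 1 t := by
  simp only [levelInd, ← Set.Iio_inter_Iio, Set.inter_indicator_one, Pi.mul_apply]

lemma integrableOn_indicator_Iio (m : ℝ) :
    IntegrableOn ((Set.Iio m).indicator (1 : ℝ → ℂ)) (Set.Ioi 0) := by
  rw [IntegrableOn, integrable_indicator_iff measurableSet_Iio, IntegrableOn,
    Measure.restrict_restrict measurableSet_Iio, Set.inter_comm, Set.Ioi_inter_Iio]
  exact integrableOn_const (by simp)

lemma integral_indicator_Iio {m : ℝ} (hm : 0 ≤ m) :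
    ∫ t in Set.Ioi (0 : ℝ), (Set.Iio m).indicator (1 : ℝ → ℂ) t = m := by
  rw [integral_indicator measurableSet_Iio,
    Measure.restrict_restrict measurableSet_Iio, Set.inter_comm, Set.Ioi_inter_Iio]
  simp [hm]

lemma inner_chi_left (f : Ω → ℝ) (hf : Measurable f) (t : ℝ) (g : Lp ℂ 2 ν) :
    inner ℂ (chi ν {x | t < f x} (measurableSet_lt measurable_const hf)) g =
      ∫ x, levelInd f t x * g x ∂ν := by
  rw [chi, L2.inner_indicatorConstLp_one,
    ← integral_indicator (measurableSet_lt measurable_const hf)]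
  refine integral_congr_ae (.of_forall fun x => ?_)
  simp [levelInd, Set.indicator_apply]

lemma inner_chi_right (f : Ω → ℝ) (hf : Measurable f) (t : ℝ) (h : Lp ℂ 2 ν) :
    inner ℂ h (chi ν {x | t < f x} (measurableSet_lt measurable_const hf)) =
      ∫ x, levelInd f t x * starRingEnd ℂ (h x) ∂ν := by
  rw [← inner_conj_symm, inner_chi_left f hf, ← integral_conj]
  refine integral_congr_ae (.of_forall fun x => ?_)
  by_cases hx : t < f x <;> simp [levelInd, hx]

/-- Since `min ≤ f z.2`, the product of `‖h‖` and `f ‖g‖`, both in `L¹`, dominates. -/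
lemma integrable_min_prod {f : Ω → ℝ} (hf : Measurable f) (hf2 : MemLp f 2 ν)
    (hf0 : 0 ≤ᵐ[ν] f) (h g : Lp ℂ 2 ν) :
    Integrable (fun z : Ω × Ω => ((min (f z.1) (f z.2) : ℝ) : ℂ) *
      (starRingEnd ℂ (h z.1) * g z.2)) (ν.prod ν) := by
  have hh : Integrable (fun y => ‖h y‖) ν := ((Lp.memLp h).integrable one_le_two).norm
  refine (hh.mul_prod (integrable_mul_norm hf2 g)).mono' ?_ ?_
  · refine AEStronglyMeasurable.mul ?_ (.mul ?_ ?_)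
    · exact (Complex.measurable_ofReal.comp ((hf.comp measurable_fst).min
        (hf.comp measurable_snd))).aestronglyMeasurable
    · exact (Complex.continuous_conj.comp_aestronglyMeasurable
        (Lp.aestronglyMeasurable h)).comp_fst
    · exact (Lp.aestronglyMeasurable g).comp_snd
  · filter_upwards [Measure.quasiMeasurePreserving_fst.ae hf0,
      Measure.quasiMeasurePreserving_snd.ae hf0] with z h1 h2
    rw [norm_mul, norm_mul, RCLike.norm_conj, Complex.norm_real,
      Real.norm_of_nonneg (le_min h1 h2)]
    calc min (f z.1) (f z.2) * (‖h z.1‖ * ‖g z.2‖) ≤ f z.2 * (‖h z.1‖ * ‖g z.2‖) := by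
          gcongr; exact min_le_right _ _
      _ = _ := by ring

/-- Tonelli: integrating the norm over `t` first gives back the norm of the `min` kernel. -/
lemma integrable_levelInd_prod {f : Ω → ℝ} (hf : Measurable f) (hf2 : MemLp f 2 ν)
    (hf0 : 0 ≤ᵐ[ν] f) (h g : Lp ℂ 2 ν) :
    Integrable (fun p : ℝ × (Ω × Ω) => (levelInd f p.1 p.2.1 * starRingEnd ℂ (h p.2.1)) *
      (levelInd f p.1 p.2.2 * g p.2.2)) ((volume.restrict (Set.Ioi 0)).prod (ν.prod ν)) := by
  have heq : ∀ (t : ℝ) (z : Ω × Ω), (levelInd f t z.1 * starRingEnd ℂ (h z.1)) *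
      (levelInd f t z.2 * g z.2) = (Set.Iio (min (f z.1) (f z.2))).indicator 1 t *
        (starRingEnd ℂ (h z.1) * g z.2) := fun t z => by
    rw [← levelInd_mul_levelInd]; ring
  have hmeas : AEStronglyMeasurable (fun p : ℝ × (Ω × Ω) =>
      (levelInd f p.1 p.2.1 * starRingEnd ℂ (h p.2.1)) *
      (levelInd f p.1 p.2.2 * g p.2.2)) ((volume.restrict (Set.Ioi 0)).prod (ν.prod ν)) := by
    refine .mul (.mul ?_ ?_) (.mul ?_ ?_)
    · exact ((measurable_levelInd hf).comp
        (measurable_fst.prodMk (measurable_fst.comp measurable_snd))).aestronglyMeasurable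
    · exact (Complex.continuous_conj.comp_aestronglyMeasurable
        (Lp.aestronglyMeasurable h)).comp_fst.comp_snd
    · exact ((measurable_levelInd hf).comp
        (measurable_fst.prodMk (measurable_snd.comp measurable_snd))).aestronglyMeasurable
    · exact (Lp.aestronglyMeasurable g).comp_snd.comp_snd
  refine (integrable_prod_iff' hmeas).2 ⟨.of_forall fun z => ?_, ?_⟩
  · simp_rw [heq]
    exact (integrableOn_indicator_Iio _).mul_const _
  · refine (integrable_min_prod hf hf2 hf0 h g).norm.congr ?_
    filter_upwards [Measure.quasiMeasurePreserving_fst.ae hf0,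
      Measure.quasiMeasurePreserving_snd.ae hf0] with z h1 h2
    have hm : 0 ≤ min (f z.1) (f z.2) := le_min h1 h2
    simp_rw [heq, norm_mul _ (starRingEnd ℂ (h z.1) * g z.2)]
    rw [integral_mul_const]
    congr 1
    rw [Complex.norm_real, Real.norm_of_nonneg hm]
    have h3 := integral_indicator_Iio hm
    have h4 : ∀ t : ℝ, (Set.Iio (min (f z.1) (f z.2))).indicator (1 : ℝ → ℂ) t =
        ((‖(Set.Iio (min (f z.1) (f z.2))).indicator (1 : ℝ → ℂ) t‖ : ℝ) : ℂ) := fun t => by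
      by_cases ht : t ∈ Set.Iio (min (f z.1) (f z.2))
      · rw [Set.indicator_of_mem ht]; simp
      · rw [Set.indicator_of_notMem ht]; simp
    rw [integral_congr_ae (.of_forall h4), integral_complex_ofReal] at h3
    exact_mod_cast h3.symm

/-- The weak form of the layer-cake representation `f̂ = ∫₀^∞ |χ_{f > t}⟩⟨χ_{f > t}| dt`. -/
lemma inner_quantization {f : Ω → ℝ} (hf : Measurable f) (hf2 : MemLp f 2 ν)
    (hf0 : 0 ≤ᵐ[ν] f) (h g : Lp ℂ 2 ν) :
    IntegrableOn (fun t : ℝ =>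
      inner ℂ h (chi ν {x | t < f x} (measurableSet_lt measurable_const hf)) *
      inner ℂ (chi ν {x | t < f x} (measurableSet_lt measurable_const hf)) g) (Set.Ioi 0) ∧
    inner ℂ h (quantization f hf hf2 hf0 g) = ∫ t in Set.Ioi (0 : ℝ),
      inner ℂ h (chi ν {x | t < f x} (measurableSet_lt measurable_const hf)) *
      inner ℂ (chi ν {x | t < f x} (measurableSet_lt measurable_const hf)) g := by
  have hI := integrable_levelInd_prod hf hf2 hf0 h g
  have hprod : ∀ t : ℝ,
      inner ℂ h (chi ν {x | t < f x} (measurableSet_lt measurable_const hf)) *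
      inner ℂ (chi ν {x | t < f x} (measurableSet_lt measurable_const hf)) g =
      ∫ z : Ω × Ω, (levelInd f t z.1 * starRingEnd ℂ (h z.1)) *
      (levelInd f t z.2 * g z.2) ∂(ν.prod ν) := fun t => by
    rw [inner_chi_left f hf, inner_chi_right f hf,
      integral_prod_mul (fun y => levelInd f t y * starRingEnd ℂ (h y))
        (fun x => levelInd f t x * g x)]
  simp_rw [hprod]
  refine ⟨hI.integral_prod_left, ?_⟩
  rw [integral_integral_swap hI]
  have h1 : ∫ z : Ω × Ω, (∫ t in Set.Ioi (0 : ℝ), (levelInd f t z.1 * starRingEnd ℂ (h z.1)) *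
      (levelInd f t z.2 * g z.2)) ∂(ν.prod ν) = ∫ z : Ω × Ω, ((min (f z.1) (f z.2) : ℝ) : ℂ) *
      (starRingEnd ℂ (h z.1) * g z.2) ∂(ν.prod ν) := by
    refine integral_congr_ae ?_
    filter_upwards [Measure.quasiMeasurePreserving_fst.ae hf0,
      Measure.quasiMeasurePreserving_snd.ae hf0] with z h1 h2
    rw [← integral_indicator_Iio (le_min h1 h2), ← integral_mul_const]
    refine integral_congr_ae (.of_forall fun t => ?_)
    simp only [← levelInd_mul_levelInd]
    ring
  rw [h1, integral_prod _ (integrable_min_prod hf hf2 hf0 h g), L2.inner_def]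
  refine integral_congr_ae ?_
  have hq : quantization f hf hf2 hf0 g =ᵐ[ν] minIntegral ν f g :=
    (memLp_minIntegral hf hf2 hf0 g).coeFn_toLp
  filter_upwards [hq] with y hy
  rw [hy, RCLike.inner_apply, minIntegral, ← integral_mul_const]
  refine integral_congr_ae (.of_forall fun x => ?_)
  simp only [min_comm (f x)]
  ring

end SuperlevelKernel

/-! ### Exchange of trace and integral -/

lemma integrableOn_measureReal_lt {f : Ω → ℝ} (hf2 : MemLp f 2 ν) (hf0 : 0 ≤ᵐ[ν] f) :
    IntegrableOn (fun t : ℝ => ν.real {x | t < f x}) (Set.Ioi 0) := by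
  have hi : Integrable f ν := hf2.integrable one_le_two
  have hanti : Antitone fun t : ℝ => ν {x | t < f x} := fun s t hst =>
    measure_mono fun x hx => lt_of_le_of_lt hst hx
  refine integrable_toReal_of_lintegral_ne_top hanti.measurable.aemeasurable ?_
  rw [← lintegral_eq_lintegral_meas_lt ν hf0 hi.aemeasurable]
  exact hi.lintegral_lt_top.ne

lemma norm_chi_sq (A : Set Ω) (hA : MeasurableSet A) : ‖chi ν A hA‖ ^ 2 = ν.real A := by
  have h := inner_self_eq_norm_sq_to_K (𝕜 := ℂ) (chi ν A hA)
  rw [chi, L2.inner_indicatorConstLp_indicatorConstLp] at h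
  simp only [Set.inter_self, inner_self_eq_norm_sq_to_K] at h
  have : ((ν.real A : ℝ) : ℂ) = ((‖chi ν A hA‖ ^ 2 : ℝ) : ℂ) := by
    rw [chi]; push_cast; simpa using h
  exact_mod_cast this.symm

/-- The diagonal terms of `ρ |χ⟩⟨χ|`. -/
lemma inner_comp_rankOne {E : Type*} [NormedAddCommGroup E] [InnerProductSpace ℂ E]
    [CompleteSpace E] {ρ : E →L[ℂ] E} (hρ : ρ.IsPositive) (e u : E) :
    inner ℂ e ((ρ ∘L rankOne ℂ u u) e) = inner ℂ (ρ e) u * inner ℂ u e := by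
  rw [ContinuousLinearMap.comp_apply, rankOne_apply, map_smul, inner_smul_right, mul_comm,
    ← ContinuousLinearMap.adjoint_inner_left, hρ.isSelfAdjoint.adjoint_eq]

/-- Parseval for `u` and `ρ u`. -/
lemma hasSum_trace_comp_rankOne {E : Type*} [NormedAddCommGroup E] [InnerProductSpace ℂ E]
    [CompleteSpace E] {ρ : E →L[ℂ] E} (hρ : ρ.IsPositive) (u : E) :
    HasSum (fun i => inner ℂ (ρ (basis E i)) u * inner ℂ u (basis E i)) (inner ℂ (ρ u) u) := by
  have h := (basis E).hasSum_inner_mul_inner u (ρ u)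
  rw [← ContinuousLinearMap.adjoint_inner_left, hρ.isSelfAdjoint.adjoint_eq] at h
  refine h.congr_fun fun i => ?_
  rw [mul_comm, ← ContinuousLinearMap.adjoint_inner_left ρ, hρ.isSelfAdjoint.adjoint_eq]

lemma qMeasure_eq {ρ : Lp ℂ 2 ν →L[ℂ] Lp ℂ 2 ν} (hρ : ρ.IsPositive) (A : Set Ω)
    (hA : MeasurableSet A) :
    qMeasure ρ A hA = inner ℂ (ρ (chi ν A hA)) (chi ν A hA) := by
  rw [← (hasSum_trace_comp_rankOne hρ (chi ν A hA)).tsum_eq, qMeasure, trace]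
  exact tsum_congr fun i => inner_comp_rankOne hρ _ _

lemma tail_sum_formula {ρ : Lp ℂ 2 ν →L[ℂ] Lp ℂ 2 ν} (hρ : ρ.IsPositive) (ht : IsTraceClass ρ)
    {f : Ω → ℝ} (hf : Measurable f) (hf2 : MemLp f 2 ν) (hf0 : 0 ≤ᵐ[ν] f) :
    IntegrableOn
      (fun t : ℝ => qMeasure ρ {x | t < f x} (measurableSet_lt measurable_const hf))
      (Set.Ioi 0) ∧
    qIntegral ρ f hf hf2 hf0 =
      ∫ t in Set.Ioi (0 : ℝ),
        qMeasure ρ {x | t < f x} (measurableSet_lt measurable_const hf) := by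
  set χ : ℝ → Lp ℂ 2 ν := fun t => chi ν {x | t < f x} (measurableSet_lt measurable_const hf)
    with hχ
  set e := basis (Lp ℂ 2 ν)
  set J := {i | ρ (e i) ≠ 0}
  have : Countable J := (countable_support_apply_basis hρ ht).to_subtype
  have hχn : ∀ t, ‖χ t‖ ^ 2 = ν.real {x | t < f x} := fun t => norm_chi_sq _ _
  have hνi := integrableOn_measureReal_lt hf2 hf0
  set F : J → ℝ → ℂ := fun i t => inner ℂ (ρ (e i)) (χ t) * inner ℂ (χ t) (e i)
  have hF : ∀ i, IntegrableOn (F i) (Set.Ioi 0) := fun i =>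
    (inner_quantization hf hf2 hf0 (ρ (e i)) (e i)).1
  have hsupp : ∀ a : Lp ℂ 2 ν → Lp ℂ 2 ν → ℂ, (∀ y, a 0 y = 0) →
      Function.support (fun i => a (ρ (e i)) (e i)) ⊆ J := fun a ha i hi h =>
    hi (by simp only [h, ha])
  have hFsum : ∀ t, HasSum (fun i => F i t) (qMeasure ρ {x | t < f x}
      (measurableSet_lt measurable_const hf)) := fun t => by
    rw [qMeasure_eq hρ]
    exact (hasSum_subtype_iff_of_support_subset
      (hsupp (fun u v => inner ℂ u (χ t) * inner ℂ (χ t) v) fun y => by simp)).2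
      (hasSum_trace_comp_rankOne hρ (χ t))
  have hFmeas : AEStronglyMeasurable (fun t : ℝ => qMeasure ρ {x | t < f x}
      (measurableSet_lt measurable_const hf)) (volume.restrict (Set.Ioi 0)) :=
    -- Countability of `J` makes `atTop` on its finite subsets countably generated, so measurability
    -- passes to the limit.
    aestronglyMeasurable_of_tendsto_ae Filter.atTop
      (f := fun (s : Finset J) t => ∑ i ∈ s, F i t)
      (fun s => Finset.aestronglyMeasurable_fun_sum s fun i _ => (hF i).aestronglyMeasurable)
      (.of_forall fun t => hFsum t)
  -- From `a b ≤ a² + b²` and Parseval for `ρ (χ t)` and `χ t`; the bound is uniform in `s`.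
  have hbound : ∀ (s : Finset J) t, ∑ i ∈ s, ‖F i t‖ ≤
      (‖ρ‖ ^ 2 + 1) * ν.real {x | t < f x} := fun s t => by
    have h1 := hasSum_norm_inner_sq e (ρ (χ t))
    have h2 := hasSum_norm_inner_sq e (χ t)
    have hle : ∀ i : J, ‖F i t‖ ≤
        ‖inner ℂ (e i) (ρ (χ t))‖ ^ 2 + ‖inner ℂ (e i) (χ t)‖ ^ 2 := fun i => by
      have : ‖F i t‖ = ‖inner ℂ (e i) (ρ (χ t))‖ * ‖inner ℂ (e i) (χ t)‖ := by
        simp only [F]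
        rw [norm_mul, norm_inner_symm (χ t), ← ContinuousLinearMap.adjoint_inner_left ρ,
          hρ.isSelfAdjoint.adjoint_eq]
      rw [this]
      nlinarith [sq_nonneg (‖inner ℂ (e i) (ρ (χ t))‖ - ‖inner ℂ (e i) (χ t)‖),
        sq_nonneg ‖inner ℂ (e i) (ρ (χ t))‖, sq_nonneg ‖inner ℂ (e i) (χ t)‖]
    calc ∑ i ∈ s, ‖F i t‖
        ≤ ∑ i ∈ s, (‖inner ℂ (e i) (ρ (χ t))‖ ^ 2 + ‖inner ℂ (e i) (χ t)‖ ^ 2) :=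
          Finset.sum_le_sum fun i _ => hle i
      _ ≤ ‖ρ (χ t)‖ ^ 2 + ‖χ t‖ ^ 2 := by
          rw [← (h1.add h2).tsum_eq]
          have := (h1.add h2).summable.sum_le_tsum (s.map (Function.Embedding.subtype _))
            fun i _ => by positivity
          rwa [Finset.sum_map] at this
      _ ≤ (‖ρ‖ * ‖χ t‖) ^ 2 + ‖χ t‖ ^ 2 := by gcongr; exact ρ.le_opNorm _
      _ = _ := by rw [← hχn]; ring
  have hint : IntegrableOn (fun t : ℝ => qMeasure ρ {x | t < f x}
      (measurableSet_lt measurable_const hf)) (Set.Ioi 0) := by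
    refine (hνi.const_mul (‖ρ‖ ^ 2 + 1)).mono' hFmeas (.of_forall fun t => ?_)
    exact le_of_tendsto' (Filter.Tendsto.norm (hFsum t)) fun s =>
      (norm_sum_le _ _).trans (hbound s t)
  refine ⟨hint, ?_⟩
  have hsum : Summable fun i => ∫ t in Set.Ioi (0 : ℝ), ‖F i t‖ :=
    summable_of_sum_le (c := ∫ t in Set.Ioi (0 : ℝ), (‖ρ‖ ^ 2 + 1) * ν.real {x | t < f x})
      (fun i => integral_nonneg fun t => norm_nonneg _) fun s => by
      rw [← integral_finsetSum s fun i _ => (hF i).norm]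
      exact integral_mono (integrable_finsetSum s fun i _ => (hF i).norm) (hνi.const_mul _)
        (hbound s)
  have hmain := (hasSum_integral_of_summable_integral_norm hF hsum).tsum_eq
  rw [integral_congr_ae (.of_forall fun t => (hFsum t).tsum_eq)] at hmain
  rw [← hmain, qIntegral, trace]
  have hdiag : ∀ i, inner ℂ (e i) ((ρ ∘L quantization f hf hf2 hf0) (e i)) =
      inner ℂ (ρ (e i)) (quantization f hf hf2 hf0 (e i)) := fun i => by
    rw [ContinuousLinearMap.comp_apply, ← ContinuousLinearMap.adjoint_inner_left,
      hρ.isSelfAdjoint.adjoint_eq]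
  rw [tsum_congr hdiag, ← tsum_subtype_eq_of_support_subset
    (hsupp (fun u v => inner ℂ u (quantization f hf hf2 hf0 v)) fun y => by simp)]
  exact tsum_congr fun i => (inner_quantization hf hf2 hf0 (ρ (e i)) (e i)).2

end QuantumIntegral

open QuantumIntegral in
theorem theorem3p4 {Ω : Type*} [MeasurableSpace Ω] (ν : Measure Ω) [IsProbabilityMeasure ν]
    (ρ : Lp ℂ 2 ν →L[ℂ] Lp ℂ 2 ν) (hρ : IsDensityOperator ρ)
    (f : Ω → ℝ) (hf : Measurable f) (hf2 : MemLp f 2 ν) (hf0 : 0 ≤ᵐ[ν] f) :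
    (∀ (A : Set Ω) (hA : MeasurableSet A),
      IsTraceClass (ρ ∘L qMeasureOp ν A hA) ∧
      qMeasure ρ A hA = inner ℂ (ρ (chi ν A hA)) (chi ν A hA)) ∧
    IsTraceClass (ρ ∘L quantization f hf hf2 hf0) ∧
    IntegrableOn
      (fun t : ℝ => qMeasure ρ {x | t < f x} (measurableSet_lt measurable_const hf))
      (Set.Ioi 0) ∧
    qIntegral ρ f hf hf2 hf0 =
      ∫ t in Set.Ioi (0 : ℝ),
        qMeasure ρ {x | t < f x} (measurableSet_lt measurable_const hf) :=
  ⟨fun A hA => ⟨hρ.isTraceClass.comp_of_isPositive hρ.isPositive _,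
    qMeasure_eq hρ.isPositive A hA⟩,
    hρ.isTraceClass.comp_of_isPositive hρ.isPositive _,
    tail_sum_formula hρ.isPositive hρ.isTraceClass hf hf2 hf0⟩
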